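/- Let $d\in\mathbb{N}=\{1,2,\dots\}$, let $\mathbb{S}^d=\{x\in\mathbb{R}^{d+1}:\|x\|_2=1\}$ and let $\pi_d$ be the normalized ($d$-dimensional) Hausdorff measure on $\mathbb{S}^d$. For $x\in\mathbb{S}^d$ and $t\in[-1,1]$ let $C(x,t)=\{y\in\mathbb{S}^d:\langle x,y\rangle>t\}$, and let $\mathcal{S}_d=\{C(x,t)\cap C(y,s): x,y\in\mathbb{S}^d,\ s,t\in[-1,1]\}$ be the set of spherical slices. For a finite set $\mathcal{P}\subseteq\mathbb{S}^d$ and $n\in\mathbb{N}$ put $$\mathrm{disp}(\mathcal{P};d)=\sup_{B\in\mathcal{S}_d,\ \mathcal{P}\cap B=\emptyset}\pi_d(B),\qquad \mathrm{disp}^*(n,d)=\inf_{\mathcal{P}\subseteq\mathbb{S}^d,\ \#\mathcal{P}=n}\mathrm{disp}(\mathcal{P};d),$$ and, for $\varepsilon>0$, let $$N(\varepsilon,d)=\min\{n\in\mathbb{N}:\mathrm{disp}^*(n,d)<\varepsilon\}$$ be the inverse of the minimal spherical dispersion. Then for every $\varepsilon\in\left(0,\frac{1}{9e}\right)$ and every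 $d\in\mathbb{N}$ this minimum exists, and $$\max\left\{\frac1\varepsilon+d-2,\ \frac1{2\varepsilon}+2d-2\right\}\le N(\varepsilon,d)\le 96\,\frac d\varepsilon\,\log\left(\frac{96}{\varepsilon}\right),$$ where $\log$ is the natural logarithm. Consequently: (i) for fixed $\varepsilon$, $N(\varepsilon,d)$ grows linearly in $d$: for every $\varepsilon\in\left(0,\frac1{9e}\right)$ there are constants $c,C>0$ (depending on $\varepsilon$) with $c\,d\le N(\varepsilon,d)\le C\,d$ for all $d\in\mathbb{N}$; (ii) for fixed $d$, $N(\varepsilon,d)$ grows linearly in $\varepsilon^{-1}$ up to a logarithmic factor in the upper bound: for every $d\in\mathbb{N}$ there are constants $c,C>0$ (depending on $d$) with $c\,\varepsilon^{-1}\le N(\varepsilon,d)\le C\,\varepsilon^{-1}\log(\varepsilon^{-1})$ for all $\varepsilon\in\left(0,\frac1{9e}\right)$. -/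

import Mathlib

open scoped ENNReal

namespace SphericalDispersion

/-- The Euclidean unit sphere of `ℝ^(d+1)`. -/
abbrev Sph (d : ℕ) : Type :=
  Metric.sphere (0 : EuclideanSpace ℝ (Fin (d + 1))) 1

/-- The normalized `d`-dimensional Hausdorff measure on the sphere (the uniform distribution). -/
noncomputable def unif (d : ℕ) : MeasureTheory.Measure (Sph d) :=
  (MeasureTheory.Measure.hausdorffMeasure (d : ℝ) (Set.univ : Set (Sph d)))⁻¹ •
    MeasureTheory.Measure.hausdorffMeasure (d : ℝ)

/-- The open spherical cap with center `x` and height parameter `t`. -/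
def cap {d : ℕ} (x : Sph d) (t : ℝ) : Set (Sph d) :=
  {y | t < inner ℝ (x : EuclideanSpace ℝ (Fin (d + 1))) (y : EuclideanSpace ℝ (Fin (d + 1)))}

/-- The spherical slices: intersections of two spherical caps. -/
def slices (d : ℕ) : Set (Set (Sph d)) :=
  {B | ∃ x y : Sph d, ∃ s ∈ Set.Icc (-1 : ℝ) 1, ∃ t ∈ Set.Icc (-1 : ℝ) 1,
    B = cap x t ∩ cap y s}

/-- The spherical dispersion of a finite point set: the supremum of the measures of the
slices that contain no point of it. -/
noncomputable def disp {d : ℕ} (P : Finset (Sph d)) : ℝ≥0∞ :=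
  ⨆ B ∈ {B ∈ slices d | (P : Set (Sph d)) ∩ B = ∅}, unif d B

/-- The minimal spherical dispersion of point sets with exactly `n` elements. -/
noncomputable def minDisp (n d : ℕ) : ℝ≥0∞ :=
  ⨅ P ∈ {P : Finset (Sph d) | P.card = n}, disp P

/-- The positive integers `n` for which the minimal dispersion is smaller than `ε`. -/
def admissible (ε : ℝ) (d : ℕ) : Set ℕ :=
  {n | 1 ≤ n ∧ minDisp n d < ENNReal.ofReal ε}

/-- The inverse `N(ε, d)` of the minimal spherical dispersion: the least admissible `n`. -/
noncomputable def invMinDisp (ε : ℝ) (d : ℕ) : ℕ :=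
  sInf (admissible ε d)

end SphericalDispersion

/-! Lower bound. Any `d` points of the sphere lie on a great subsphere, whose two open hemispheres
avoid them; two such subspheres give four lunes avoiding `2d` points. Each further point costs at
most one more piece: the lune containing it is cut along a great subsphere through that point,
chosen so that both halves are again lunes. Up to a null set the sphere is then covered by `n - d +
2`, or by `n - 2d + 4`, slices free of the `n` points, so one of them has measure at least the
reciprocal of that number (`one_le_mul_disp`, `one_le_mul_disp'`).

Upper bound. This is the ε-net theorem (`HasGrowthBound.exists_sample`) for samples from the uniform
measure. By Radon's theorem caps have VC dimension at most `d + 2`, so by Sauer–Shelah slices cut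
out only polynomially many (in `n`) subsets of `2n` points. Symmetrization against a second sample
then yields `n` points hitting every slice of measure at least `ε / 2` in a countable family. Each
slice is approximated from inside by that family, so all slices are covered. -/

namespace SphericalDispersion

open MeasureTheory Set
open scoped NNReal

/-! ### Hausdorff measure of the sphere and of great subspheres -/

/-- The face `{z | z i = c}` of the cube, projected radially to the sphere. -/
noncomputable def cubeFaceToSphere {m : ℕ} (i : Fin (m + 1)) (c : ℝ) (y : Fin m → ℝ) :
    EuclideanSpace ℝ (Fin (m + 1)) :=
  ‖WithLp.toLp 2 (i.insertNth c y : Fin (m + 1) → ℝ)‖⁻¹ •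
    (WithLp.toLp 2 (i.insertNth c y : Fin (m + 1) → ℝ) : EuclideanSpace ℝ (Fin (m + 1)))

lemma contDiff_cubeFaceToSphere {m : ℕ} (i : Fin (m + 1)) {c : ℝ} (hc : c ≠ 0) :
    ContDiff ℝ 1 (cubeFaceToSphere (m := m) i c) := by
  have h1 : ContDiff ℝ 1 (fun y : Fin m → ℝ =>
      (WithLp.toLp 2 (i.insertNth c y : Fin (m + 1) → ℝ) : EuclideanSpace ℝ (Fin (m + 1)))) := by
    rw [contDiff_euclidean, Fin.forall_iff_succAbove i]
    refine ⟨by simpa using contDiff_const, fun j => ?_⟩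
    simpa using contDiff_apply ℝ ℝ j
  have h0 : ∀ y : Fin m → ℝ, (WithLp.toLp 2 (i.insertNth c y : Fin (m + 1) → ℝ) :
      EuclideanSpace ℝ (Fin (m + 1))) ≠ 0 := by
    intro y h
    apply hc
    simpa using congrArg (fun z : EuclideanSpace ℝ (Fin (m + 1)) => z i) h
  exact ((h1.norm ℝ h0).inv fun y => norm_ne_zero_iff.2 (h0 y)).smul h1

/-- Dividing a point by its largest absolute coordinate moves it onto a face of the cube
`[-1,1]^(m+1)`; normalizing brings it back. -/
lemma sphere_subset_iUnion_cubeFaces (m : ℕ) :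
    Metric.sphere (0 : EuclideanSpace ℝ (Fin (m + 1))) 1 ⊆
      ⋃ p ∈ (Finset.univ ×ˢ {1, -1} : Finset (Fin (m + 1) × ℝ)),
        cubeFaceToSphere p.1 p.2 '' Icc (-1) 1 := by
  intro z hz
  have hz1 : ‖z‖ = 1 := by simpa using hz
  obtain ⟨i, -, hi⟩ := Finset.exists_max_image Finset.univ (fun i => |z i|) Finset.univ_nonempty
  have hi0 : 0 < |z i| := by
    by_contra! h
    have : z = 0 := by
      ext j
      exact abs_nonpos_iff.1 ((hi j (Finset.mem_univ _)).trans h)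
    simp [this] at hz1
  have hzi : z i ≠ 0 := abs_pos.1 hi0
  have hscale : (WithLp.toLp 2 (i.insertNth (z i / |z i|) (fun j => z (i.succAbove j) / |z i|) :
      Fin (m + 1) → ℝ) : EuclideanSpace ℝ (Fin (m + 1))) = |z i|⁻¹ • z := by
    ext j
    revert j
    rw [Fin.forall_iff_succAbove i]
    exact ⟨by simp [div_eq_inv_mul], fun j => by simp [div_eq_inv_mul]⟩
  simp only [mem_iUnion]
  refine ⟨(i, z i / |z i|), ?_, fun j => z (i.succAbove j) / |z i|, ?_, ?_⟩
  · simp only [Finset.mem_product, Finset.mem_univ, Finset.mem_insert, Finset.mem_singleton,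
      true_and]
    rcases lt_or_gt_of_ne hzi with h | h
    · right; rw [abs_of_neg h]; field_simp
    · left; rw [abs_of_pos h]; field_simp
  · have key : ∀ j, abs (z (i.succAbove j) / |z i|) ≤ 1 := fun j => by
      rw [abs_div, abs_abs]
      exact div_le_one_of_le₀ (hi _ (Finset.mem_univ _)) (abs_nonneg _)
    exact ⟨fun j => (abs_le.1 (key j)).1, fun j => (abs_le.1 (key j)).2⟩
  · simp only [cubeFaceToSphere, hscale, norm_smul, hz1, smul_smul]
    simp [hi0.ne']

/-- The sphere is covered by finitely many images of the cube `[-1,1]^m` under `C¹` maps, which are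
Lipschitz on this compact convex set. -/
lemma hausdorffMeasure_sphere_lt_top (m : ℕ) :
    μH[m] (Metric.sphere (0 : EuclideanSpace ℝ (Fin (m + 1))) 1) < ∞ := by
  refine (measure_mono (sphere_subset_iUnion_cubeFaces m)).trans_lt ?_
  refine (measure_biUnion_lt_top (Finset.finite_toSet _) fun p hp => ?_)
  have hp2 : p.2 ≠ 0 := by
    have : p.2 = 1 ∨ p.2 = -1 := by simpa using hp
    rcases this with h | h <;> rw [h] <;> norm_num
  obtain ⟨K, hK⟩ := (contDiff_cubeFaceToSphere p.1 hp2).contDiffOn.exists_lipschitzOnWith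
    one_ne_zero (convex_Icc (-1 : Fin m → ℝ) 1) isCompact_Icc
  refine (hK.hausdorffMeasure_image_le (Nat.cast_nonneg m)).trans_lt ?_
  refine ENNReal.mul_lt_top (by simp) ?_
  have hvol : (μH[m] : Measure (Fin m → ℝ)) = volume := by
    simpa using hausdorffMeasure_pi_real (ι := Fin m)
  rw [hvol]
  exact isCompact_Icc.measure_lt_top

/-- Forgetting one coordinate is 1-Lipschitz and maps the sphere onto a set containing the open unit
ball of `ℝ^m`. -/
lemma hausdorffMeasure_sphere_pos (m : ℕ) :
    0 < μH[m] (Metric.sphere (0 : EuclideanSpace ℝ (Fin (m + 1))) 1) := by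
  let f : EuclideanSpace ℝ (Fin (m + 1)) → (Fin m → ℝ) := fun z j => z j.succ
  have hf : LipschitzWith 1 f := by
    refine LipschitzWith.of_dist_le_mul fun x y => ?_
    rw [NNReal.coe_one, one_mul, dist_pi_le_iff dist_nonneg]
    intro j
    simpa [f, dist_eq_norm] using PiLp.norm_apply_le (x - y) j.succ
  have hsub : {y : Fin m → ℝ | ∑ j, y j ^ 2 < 1} ⊆ f '' Metric.sphere 0 1 := by
    intro y hy
    have hy' : ∑ j, y j ^ 2 < 1 := hy
    refine ⟨WithLp.toLp 2 (Fin.cons (√(1 - ∑ j, y j ^ 2)) y), ?_, ?_⟩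
    · rw [mem_sphere_zero_iff_norm, EuclideanSpace.norm_eq, Fin.sum_univ_succ]
      simp [Real.sq_sqrt (sub_nonneg.2 hy'.le)]
    · ext j; simp [f]
  have hopen : IsOpen {y : Fin m → ℝ | ∑ j, y j ^ 2 < 1} :=
    isOpen_lt (by fun_prop) continuous_const
  have hvol : (μH[m] : Measure (Fin m → ℝ)) = volume := by
    simpa using hausdorffMeasure_pi_real (ι := Fin m)
  have hpos : 0 < μH[m] {y : Fin m → ℝ | ∑ j, y j ^ 2 < 1} := by
    rw [hvol]
    exact hopen.measure_pos _ ⟨0, by simp⟩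
  refine hpos.trans_le ((measure_mono hsub).trans ?_)
  simpa using hf.hausdorffMeasure_image_le (Nat.cast_nonneg m) (Metric.sphere 0 1)

lemma hausdorffMeasure_val_image {d : ℕ} (s : Set (Sph d)) :
    μH[d] (Subtype.val '' s : Set (EuclideanSpace ℝ (Fin (d + 1)))) = μH[d] s :=
  isometry_subtype_coe.hausdorffMeasure_image (Or.inl (Nat.cast_nonneg d)) s

instance isProbabilityMeasure_unif (d : ℕ) : IsProbabilityMeasure (unif d) := by
  have h : μH[d] (Set.univ : Set (Sph d)) =
      μH[d] (Metric.sphere (0 : EuclideanSpace ℝ (Fin (d + 1))) 1) := by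
    rw [← hausdorffMeasure_val_image, Set.image_univ, Subtype.range_coe]
  refine ⟨?_⟩
  rw [unif, Measure.smul_apply, smul_eq_mul, h]
  exact ENNReal.inv_mul_cancel (hausdorffMeasure_sphere_pos d).ne'
    (hausdorffMeasure_sphere_lt_top d).ne

/-- Great subspheres are null sets. -/
lemma unif_greatSubsphere {d : ℕ} (hd : 1 ≤ d) {u : EuclideanSpace ℝ (Fin (d + 1))} (hu : u ≠ 0) :
    unif d {y : Sph d | inner ℝ u (y : EuclideanSpace ℝ (Fin (d + 1))) = 0} = 0 := by
  obtain ⟨m, rfl⟩ : ∃ m, d = m + 1 := ⟨d - 1, by omega⟩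
  rw [unif, Measure.smul_apply, ← hausdorffMeasure_val_image {y : Sph (m + 1) | _}]
  have hfin : Module.finrank ℝ (ℝ ∙ u)ᗮ = m + 1 := by
    have : Fact (Module.finrank ℝ (EuclideanSpace ℝ (Fin (m + 1 + 1))) = m + 1 + 1) := ⟨by simp⟩
    exact Submodule.finrank_orthogonal_span_singleton hu
  let e : EuclideanSpace ℝ (Fin (m + 1)) ≃ₗᵢ[ℝ] (ℝ ∙ u)ᗮ :=
    ((stdOrthonormalBasis ℝ (ℝ ∙ u)ᗮ).reindex (finCongr hfin)).repr.symm
  let g : EuclideanSpace ℝ (Fin (m + 1)) → EuclideanSpace ℝ (Fin (m + 1 + 1)) := fun z => e z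
  have hg : Isometry g := isometry_subtype_coe.comp e.isometry
  have hsub : (Subtype.val '' {y : Sph (m + 1) | inner ℝ u (y : EuclideanSpace ℝ _) = 0} :
      Set (EuclideanSpace ℝ (Fin (m + 1 + 1)))) ⊆ g '' Metric.sphere 0 1 := by
    rintro _ ⟨y, hy, rfl⟩
    have hy' : (y : EuclideanSpace ℝ (Fin (m + 1 + 1))) ∈ (ℝ ∙ u)ᗮ :=
      Submodule.mem_orthogonal_singleton_iff_inner_right.2 hy
    refine ⟨e.symm ⟨y, hy'⟩, ?_, by simp [g]⟩
    rw [mem_sphere_zero_iff_norm, LinearIsometryEquiv.norm_map]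
    simp
  -- Finite `m`-dimensional measure forces the `(m+1)`-dimensional measure to vanish.
  have hlt : μH[m] (g '' Metric.sphere 0 1) < ∞ := by
    rw [hg.hausdorffMeasure_image (Or.inl (Nat.cast_nonneg m))]
    exact hausdorffMeasure_sphere_lt_top m
  have hmm : (m : ℝ) < ((m + 1 : ℕ) : ℝ) := by push_cast; linarith
  rcases Measure.hausdorffMeasure_zero_or_top hmm (g '' Metric.sphere 0 1) with h | h
  · rw [measure_mono_null hsub h, smul_zero]
  · exact absurd h hlt.ne

/-! ### Lune partitions and the lower bounds -/

/-- Intersection of two open hemispheres. -/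
def lune {d : ℕ} (x y : Sph d) : Set (Sph d) := cap x 0 ∩ cap y 0

lemma mem_lune {d : ℕ} {x y z : Sph d} :
    z ∈ lune x y ↔ 0 < inner ℝ x.1 z.1 ∧ 0 < inner ℝ y.1 z.1 := Iff.rfl

lemma lune_mem_slices {d : ℕ} (x y : Sph d) : lune x y ∈ slices d :=
  ⟨x, y, 0, by simp, 0, by simp, rfl⟩

lemma isOpen_cap {d : ℕ} (x : Sph d) (t : ℝ) : IsOpen (cap x t) :=
  isOpen_lt continuous_const (continuous_const.inner continuous_subtype_val)

lemma inner_neg_sph {d : ℕ} (w z : Sph d) :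
    inner ℝ (-w).1 z.1 = -(inner ℝ w.1 z.1 : ℝ) := by
  rw [show (-w).1 = -w.1 from rfl, inner_neg_left]

/-- Any nonzero vector has a positive multiple on the sphere. -/
lemma exists_sph_inner {d : ℕ} {u : EuclideanSpace ℝ (Fin (d + 1))} (hu : u ≠ 0) :
    ∃ w : Sph d, ∃ c : ℝ, 0 < c ∧ ∀ v : EuclideanSpace ℝ (Fin (d + 1)),
      inner ℝ w.1 v = c * inner ℝ u v := by
  refine ⟨⟨‖u‖⁻¹ • u, ?_⟩, ‖u‖⁻¹, inv_pos.2 (norm_pos_iff.2 hu), fun v => ?_⟩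
  · rw [mem_sphere_zero_iff_norm, norm_smul, norm_inv, norm_norm,
      inv_mul_cancel₀ (norm_ne_zero_iff.2 hu)]
  · rw [inner_smul_left]; simp

lemma exists_sph_orthogonal {d : ℕ} (A : Finset (Sph d)) (hA : A.card ≤ d) :
    ∃ w : Sph d, ∀ p ∈ A, inner ℝ w.1 p.1 = 0 := by
  classical
  set W : Submodule ℝ (EuclideanSpace ℝ (Fin (d + 1))) :=
    Submodule.span ℝ (A.image Subtype.val : Finset (EuclideanSpace ℝ (Fin (d + 1)))) with hW
  have hlt : Module.finrank ℝ W < d + 1 :=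
    ((finrank_span_finset_le_card _).trans Finset.card_image_le).trans_lt (by omega)
  have hne : Wᗮ ≠ ⊥ := by
    intro h
    rw [Submodule.orthogonal_eq_bot_iff] at h
    rw [h, finrank_top] at hlt
    simp at hlt
  obtain ⟨u, huW, hu0⟩ := Submodule.exists_mem_ne_zero_of_ne_bot hne
  obtain ⟨w, c, -, hw⟩ := exists_sph_inner hu0
  refine ⟨w, fun p hp => ?_⟩
  rw [hw, Submodule.inner_left_of_mem_orthogonal (K := W) (Submodule.subset_span ?_) huW, mul_zero]
  simpa using hp

/-- Up to scaling, `w` is the combination of `x` and `y` orthogonal to `p`. On the side `w > 0` the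
constraint from `x` becomes redundant, on `w < 0` the one from `y`, so each half of the lune needs
only two hemispheres. If the combination vanishes, the lune is a hemisphere and any `w` orthogonal
to `p` works. -/
lemma exists_splitting_vector {d : ℕ} (hd : 1 ≤ d) {x y p : Sph d} (hp : p ∈ lune x y) :
    ∃ w : Sph d, inner ℝ w.1 p.1 = 0 ∧
      (∀ z : Sph d, 0 < inner ℝ w.1 z.1 → 0 < inner ℝ y.1 z.1 → 0 < inner ℝ x.1 z.1) ∧
      (∀ z : Sph d, inner ℝ w.1 z.1 < 0 → 0 < inner ℝ x.1 z.1 → 0 < inner ℝ y.1 z.1) := by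
  obtain ⟨ha, hb⟩ := mem_lune.1 hp
  set a : ℝ := inner ℝ x.1 p.1
  set b : ℝ := inner ℝ y.1 p.1
  set u := b • x.1 - a • y.1 with hu
  have huin : ∀ v, inner ℝ u v = b * inner ℝ x.1 v - a * inner ℝ y.1 v := fun v => by
    simp [hu, inner_sub_left, inner_smul_left]
  by_cases h0 : u = 0
  · obtain ⟨w, hw⟩ := exists_sph_orthogonal {p} (by simpa using hd)
    have hxy : ∀ v, b * inner ℝ x.1 v = a * inner ℝ y.1 v := fun v => by
      have := huin v
      rw [h0, inner_zero_left] at this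
      linarith
    refine ⟨w, hw p (by simp), fun z _ hz => ?_, fun z _ hz => ?_⟩
    · exact pos_of_mul_pos_right (by rw [hxy]; positivity) hb.le
    · exact pos_of_mul_pos_right (by rw [← hxy]; positivity) ha.le
  · obtain ⟨w, c, hc, hw⟩ := exists_sph_inner h0
    refine ⟨w, ?_, fun z hz1 hz2 => ?_, fun z hz1 hz2 => ?_⟩
    · rw [hw, huin]
      change c * (b * a - a * b) = 0
      ring
    · rw [hw, huin] at hz1
      have := pos_of_mul_pos_right hz1 hc.le
      have h2 : 0 < a * inner ℝ y.1 z.1 := by positivity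
      exact pos_of_mul_pos_right (by linarith) hb.le
    · rw [hw, huin] at hz1
      have := neg_of_mul_neg_right hz1 hc.le
      have h2 : 0 < b * inner ℝ x.1 z.1 := by positivity
      exact pos_of_mul_pos_right (by linarith) ha.le

/-- A finite family of disjoint lunes that cover the sphere up to a null set. -/
structure IsLunePartition {d : ℕ} (F : Finset (Set (Sph d))) : Prop where
  exists_eq_lune : ∀ B ∈ F, ∃ x y, B = lune x y
  disjoint : (F : Set (Set (Sph d))).PairwiseDisjoint id
  ae_mem : ∀ᵐ z ∂(unif d), ∃ B ∈ F, z ∈ B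

lemma ae_inner_ne_zero {d : ℕ} (hd : 1 ≤ d) (w : Sph d) :
    ∀ᵐ z : Sph d ∂(unif d), (inner ℝ w.1 z.1 : ℝ) ≠ 0 := by
  rw [ae_iff]
  simpa using unif_greatSubsphere hd (u := w.1) (by
    intro h
    have := w.2
    rw [h] at this
    simp at this)

/-- Splitting lunes, one can make a lune partition miss finitely many more points,
at the cost of one more lune for each point. -/
lemma IsLunePartition.exists_refinement {d : ℕ} (hd : 1 ≤ d) {F : Finset (Set (Sph d))}
    (hF : IsLunePartition F) (Q : Finset (Sph d)) :
    ∃ G : Finset (Set (Sph d)), IsLunePartition G ∧ G.card ≤ F.card + Q.card ∧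
      (∀ B ∈ G, ∃ B' ∈ F, B ⊆ B') ∧ ∀ B ∈ G, ∀ q ∈ Q, q ∉ B := by
  classical
  induction Q using Finset.induction_on with
  | empty => exact ⟨F, hF, by simp, fun B hB => ⟨B, hB, Subset.rfl⟩, by simp⟩
  | insert p Q hpQ ih =>
    obtain ⟨G, hG, hcard, hsub, hmiss⟩ := ih
    by_cases hp : ∃ B ∈ G, p ∈ B
    · obtain ⟨B, hB, hpB⟩ := hp
      obtain ⟨x, y, rfl⟩ := hG.exists_eq_lune B hB
      obtain ⟨w, hwp, hw1, hw2⟩ := exists_splitting_vector hd hpB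
      have hs1 : lune w y ⊆ lune x y := fun z hz => by
        rw [mem_lune] at hz ⊢
        exact ⟨hw1 z hz.1 hz.2, hz.2⟩
      have hs2 : lune x (-w) ⊆ lune x y := fun z hz => by
        rw [mem_lune, inner_neg_sph] at hz
        exact mem_lune.2 ⟨hz.1, hw2 z (by linarith [hz.2]) hz.1⟩
      have hdis : Disjoint (lune w y) (lune x (-w)) := by
        rw [Set.disjoint_left]
        intro z h1 h2
        rw [mem_lune] at h1
        rw [mem_lune, inner_neg_sph] at h2
        linarith [h1.1, h2.2]
      have hother : ∀ C ∈ G.erase (lune x y), Disjoint (lune x y) C := fun C hC =>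
        hG.disjoint hB (Finset.mem_of_mem_erase hC) (Finset.ne_of_mem_erase hC).symm
      refine ⟨insert (lune w y) (insert (lune x (-w)) (G.erase (lune x y))), ⟨?_, ?_, ?_⟩,
        ?_, ?_, ?_⟩
      · intro C hC
        rw [Finset.mem_insert, Finset.mem_insert] at hC
        rcases hC with rfl | rfl | hC
        · exact ⟨_, _, rfl⟩
        · exact ⟨_, _, rfl⟩
        · exact hG.exists_eq_lune C (Finset.mem_of_mem_erase hC)
      · rw [Finset.coe_insert, Finset.coe_insert]
        refine ((hG.disjoint.subset ?_).insert ?_).insert ?_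
        · exact_mod_cast Finset.erase_subset _ _
        · exact fun C hC _ => (hother C hC).mono_left hs2
        · rintro C (rfl | hC) _
          · exact hdis
          · exact (hother C hC).mono_left hs1
      · filter_upwards [hG.ae_mem, ae_inner_ne_zero hd w] with z ⟨C, hC, hzC⟩ hz
        by_cases hCB : C = lune x y
        · subst hCB
          rw [mem_lune] at hzC
          rcases lt_or_gt_of_ne hz with h | h
          · exact ⟨lune x (-w), by simp, by rw [mem_lune, inner_neg_sph]; exact ⟨hzC.1, by linarith⟩⟩
          · exact ⟨lune w y, by simp, mem_lune.2 ⟨h, hzC.2⟩⟩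
        · exact ⟨C, by simp [hCB, hC], hzC⟩
      · have h1 := Finset.card_insert_le (lune w y) (insert (lune x (-w)) (G.erase (lune x y)))
        have h2 := Finset.card_insert_le (lune x (-w)) (G.erase (lune x y))
        have h3 := Finset.card_erase_add_one hB
        rw [Finset.card_insert_of_notMem hpQ]
        omega
      · intro C hC
        rw [Finset.mem_insert, Finset.mem_insert] at hC
        rcases hC with rfl | rfl | hC
        · exact (hsub _ hB).imp fun D hD => ⟨hD.1, hs1.trans hD.2⟩
        · exact (hsub _ hB).imp fun D hD => ⟨hD.1, hs2.trans hD.2⟩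
        · exact hsub C (Finset.mem_of_mem_erase hC)
      · intro C hC q hq
        rw [Finset.mem_insert] at hq
        rw [Finset.mem_insert, Finset.mem_insert] at hC
        rcases hq with rfl | hq
        -- The point `p` lies on the cutting subsphere, hence in neither open half.
        · rcases hC with rfl | rfl | hC
          · rw [mem_lune, hwp]; simp
          · rw [mem_lune, inner_neg_sph, hwp]; simp
          · exact Set.disjoint_left.1 (hother C hC) hpB
        · rcases hC with rfl | rfl | hC
          · exact fun h => hmiss _ hB q hq (hs1 h)
          · exact fun h => hmiss _ hB q hq (hs2 h)
          · exact hmiss C (Finset.mem_of_mem_erase hC) q hq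
    · push Not at hp
      refine ⟨G, hG, ?_, hsub, ?_⟩
      · rw [Finset.card_insert_of_notMem hpQ]; omega
      · intro B hB q hq
        rcases Finset.mem_insert.1 hq with rfl | hq
        · exact hp B hB
        · exact hmiss B hB q hq

lemma IsLunePartition.one_le_card_mul_disp {d : ℕ} {F : Finset (Set (Sph d))}
    (hF : IsLunePartition F) {P : Finset (Sph d)} (hP : ∀ B ∈ F, ∀ p ∈ P, p ∉ B) :
    1 ≤ (F.card : ℝ≥0∞) * disp P := by
  have h1 : unif d (⋃ B ∈ F, B) = 1 := by
    have hae : (⋃ B ∈ F, B) =ᵐ[unif d] (Set.univ : Set (Sph d)) := by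
      rw [Filter.eventuallyEq_univ]
      filter_upwards [hF.ae_mem] with z hz
      simpa using hz
    rw [measure_congr hae, measure_univ]
  calc (1 : ℝ≥0∞) = unif d (⋃ B ∈ F, B) := h1.symm
    _ ≤ ∑ B ∈ F, unif d B := measure_biUnion_finset_le _ _
    _ ≤ ∑ _B ∈ F, disp P := by
        refine Finset.sum_le_sum fun B hB => ?_
        obtain ⟨x, y, rfl⟩ := hF.exists_eq_lune B hB
        refine le_iSup₂_of_le (lune x y) ⟨lune_mem_slices x y, ?_⟩ le_rfl
        exact Set.disjoint_iff_inter_eq_empty.1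
          (Set.disjoint_left.2 fun p hp => hP _ hB p (by simpa using hp))
    _ = _ := by simp

lemma isLunePartition_hemispheres {d : ℕ} (hd : 1 ≤ d) (x : Sph d) [DecidableEq (Set (Sph d))] :
    IsLunePartition {lune x x, lune (-x) (-x)} := by
  refine ⟨?_, ?_, ?_⟩
  · intro B hB
    rw [Finset.mem_insert, Finset.mem_singleton] at hB
    rcases hB with rfl | rfl <;> exact ⟨_, _, rfl⟩
  · rw [Finset.coe_insert, Finset.coe_singleton, Set.pairwiseDisjoint_insert]
    refine ⟨Set.pairwiseDisjoint_singleton _ _, ?_⟩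
    rintro C rfl _
    rw [id, id, Set.disjoint_left]
    intro z h1 h2
    rw [mem_lune] at h1
    rw [mem_lune, inner_neg_sph] at h2
    linarith [h1.1, h2.2]
  · filter_upwards [ae_inner_ne_zero hd x] with z hz
    rcases lt_or_gt_of_ne hz with h | h
    · exact ⟨lune (-x) (-x), by simp, by rw [mem_lune, inner_neg_sph]; simpa using h⟩
    · exact ⟨lune x x, by simp, mem_lune.2 ⟨h, h⟩⟩

lemma isLunePartition_quarters {d : ℕ} (hd : 1 ≤ d) (x y : Sph d) [DecidableEq (Set (Sph d))] :
    IsLunePartition {lune x y, lune x (-y), lune (-x) y, lune (-x) (-y)} := by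
  refine ⟨?_, ?_, ?_⟩
  · intro B hB
    simp only [Finset.mem_insert, Finset.mem_singleton] at hB
    rcases hB with rfl | rfl | rfl | rfl <;> exact ⟨_, _, rfl⟩
  · intro B hB C hC hne
    simp only [Finset.coe_insert, Finset.coe_singleton, Set.mem_insert_iff,
      Set.mem_singleton_iff] at hB hC
    rw [Function.onFun, id, id, Set.disjoint_left]
    intro z h1 h2
    apply hne
    rcases hB with rfl | rfl | rfl | rfl <;> rcases hC with rfl | rfl | rfl | rfl <;>
      first
      | rfl
      | (simp only [mem_lune, inner_neg_sph] at h1 h2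
         exfalso
         linarith [h1.1, h1.2, h2.1, h2.2])
  · filter_upwards [ae_inner_ne_zero hd x, ae_inner_ne_zero hd y] with z hx hy
    rcases lt_or_gt_of_ne hx with h | h <;> rcases lt_or_gt_of_ne hy with h' | h'
    · exact ⟨lune (-x) (-y), by simp, by simp [mem_lune, h, h']⟩
    · exact ⟨lune (-x) y, by simp, by simp [mem_lune, h, h']⟩
    · exact ⟨lune x (-y), by simp, by simp [mem_lune, h, h']⟩
    · exact ⟨lune x y, by simp, by simp [mem_lune, h, h']⟩

lemma exists_subset_card_eq_min {α : Type*} (P : Finset α) (d : ℕ) :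
    ∃ A ⊆ P, A.card = min d P.card :=
  Finset.exists_subset_card_eq (min_le_right _ _)

/-- The points of `A` lie on the common boundary of the starting hemispheres, so only the other
points of `P` require a split. -/
lemma one_le_mul_disp {d : ℕ} (hd : 1 ≤ d) (P : Finset (Sph d)) :
    1 ≤ ((2 + (P.card - d) : ℕ) : ℝ≥0∞) * disp P := by
  classical
  obtain ⟨A, hAP, hA⟩ := exists_subset_card_eq_min P d
  obtain ⟨x, hx⟩ := exists_sph_orthogonal A (by omega)
  obtain ⟨G, hG, hcard, hsub, hmiss⟩ :=
    (isLunePartition_hemispheres hd x).exists_refinement hd (P \ A)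
  refine (hG.one_le_card_mul_disp (P := P) fun B hB p hp => ?_).trans ?_
  · by_cases hpA : p ∈ A
    · obtain ⟨B', hB', hBB'⟩ := hsub B hB
      refine fun h => ?_
      have h' := hBB' h
      rw [Finset.mem_insert, Finset.mem_singleton] at hB'
      rcases hB' with rfl | rfl <;> simp [mem_lune, hx p hpA] at h'
    · exact hmiss B hB p (by simp [hp, hpA])
  · gcongr
    have h1 := Finset.card_sdiff_add_card_eq_card hAP
    have h2 := Finset.card_le_two (a := lune x x) (b := lune (-x) (-x))
    omega

lemma one_le_mul_disp' {d : ℕ} (hd : 1 ≤ d) (P : Finset (Sph d)) :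
    1 ≤ ((4 + (P.card - 2 * d) : ℕ) : ℝ≥0∞) * disp P := by
  classical
  obtain ⟨A, hAP, hA⟩ := exists_subset_card_eq_min P d
  obtain ⟨A', hAP', hA'⟩ := exists_subset_card_eq_min (P \ A) d
  obtain ⟨x, hx⟩ := exists_sph_orthogonal A (by omega)
  obtain ⟨y, hy⟩ := exists_sph_orthogonal A' (by omega)
  obtain ⟨G, hG, hcard, hsub, hmiss⟩ :=
    (isLunePartition_quarters hd x y).exists_refinement hd ((P \ A) \ A')
  refine (hG.one_le_card_mul_disp (P := P) fun B hB p hp => ?_).trans ?_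
  · by_cases hpA : p ∈ A ∨ p ∈ A'
    · obtain ⟨B', hB', hBB'⟩ := hsub B hB
      refine fun h => ?_
      have h' := hBB' h
      simp only [Finset.mem_insert, Finset.mem_singleton] at hB'
      rcases hpA with hpA | hpA
      · rcases hB' with rfl | rfl | rfl | rfl <;> simp [mem_lune, hx p hpA] at h'
      · rcases hB' with rfl | rfl | rfl | rfl <;> simp [mem_lune, hy p hpA] at h'
    · push Not at hpA
      exact hmiss B hB p (by simp [hp, hpA])
  · gcongr
    have h1 := Finset.card_sdiff_add_card_eq_card hAP
    have h1' := Finset.card_sdiff_add_card_eq_card hAP'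
    have h2 := Finset.card_le_four (a := lune x y) (b := lune x (-y)) (c := lune (-x) y)
      (d := lune (-x) (-y))
    omega

lemma one_div_lt_of_one_le_mul {m : ℕ} {δ : ℝ≥0∞} {ε : ℝ} (hε : 0 < ε)
    (h : 1 ≤ (m : ℝ≥0∞) * δ) (hδ : δ < ENNReal.ofReal ε) : 1 / ε < m := by
  have hm : m ≠ 0 := by rintro rfl; simp at h
  have h1 : (1 : ℝ≥0∞) < ENNReal.ofReal (m * ε) := by
    rw [ENNReal.ofReal_mul (Nat.cast_nonneg m), ENNReal.ofReal_natCast]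
    exact h.trans_lt (ENNReal.mul_lt_mul_right (by simpa using hm) (by simp) hδ)
  rw [← ENNReal.ofReal_one, ENNReal.ofReal_lt_ofReal_iff_of_nonneg zero_le_one] at h1
  rwa [div_lt_iff₀ hε]

lemma lower_bounds_of_mem_admissible {ε : ℝ} (hε : 0 < ε) (hε' : ε < 1 / 4) {d n : ℕ} (hd : 1 ≤ d)
    (hn : n ∈ admissible ε d) :
    1 / ε + (d : ℝ) - 2 ≤ n ∧ 1 / ε + 2 * (d : ℝ) - 4 ≤ n := by
  obtain ⟨P, hP, hPε⟩ : ∃ P : Finset (Sph d), P.card = n ∧ disp P < ENNReal.ofReal ε := by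
    simpa [minDisp, iInf_lt_iff] using hn.2
  have h4 : 4 < 1 / ε := by rw [lt_div_iff₀ hε]; linarith
  have h1 := one_div_lt_of_one_le_mul hε (one_le_mul_disp hd P) hPε
  have h2 := one_div_lt_of_one_le_mul hε (one_le_mul_disp' hd P) hPε
  rw [hP] at h1 h2
  constructor
  · rcases le_total d n with h | h
    · push_cast [Nat.cast_sub h] at h1; linarith
    -- Here the truncated difference is `0`, and `1 / ε < 2` contradicts `4 < 1 / ε`.
    · rw [Nat.sub_eq_zero_of_le h] at h1; norm_num at h1; norm_num at h4; linarith
  · rcases le_total (2 * d) n with h | h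
    · push_cast [Nat.cast_sub h] at h2; linarith
    · rw [Nat.sub_eq_zero_of_le h] at h2; norm_num at h2; norm_num at h4; linarith

/-! ### The ε-net theorem by symmetrization -/

section EpsilonNet

variable {Ω : Type*} {n k : ℕ}

-- All counted `σ` agree on the set `J` of one fixed `σ₀`: disagreeing at `i ∈ J` would put `(i, σ
-- i) = (i, !σ₀ i)` in `T`. This leaves at most `n - |J| ≤ n - k` free bits.
open Classical in
lemma card_swaps_mul_le (T : Finset (Fin n × Bool)) :
    (Finset.univ.filter fun σ : Fin n → Bool =>
      (∀ i, (i, σ i) ∉ T) ∧ k ≤ (Finset.univ.filter fun i => (i, !σ i) ∈ T).card).card * 2 ^ k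
      ≤ 2 ^ n := by
  set S := Finset.univ.filter fun σ : Fin n → Bool =>
    (∀ i, (i, σ i) ∉ T) ∧ k ≤ (Finset.univ.filter fun i => (i, !σ i) ∈ T).card with hS
  rcases S.eq_empty_or_nonempty with h | ⟨σ₀, hσ₀⟩
  · simp [h]
  obtain ⟨-, -, hk⟩ := Finset.mem_filter.1 hσ₀
  set J := Finset.univ.filter fun i => (i, !σ₀ i) ∈ T with hJ
  have hsub : S ⊆ Fintype.piFinset fun i => if i ∈ J then {σ₀ i} else Finset.univ := by
    intro σ hσ
    obtain ⟨-, h1, -⟩ := Finset.mem_filter.1 hσ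
    rw [Fintype.mem_piFinset]
    intro i
    split_ifs with hi
    · have hi' : (i, !σ₀ i) ∈ T := by simpa [hJ] using hi
      rw [Finset.mem_singleton]
      by_contra hne
      exact h1 i (by rwa [Bool.eq_not_of_ne hne])
    · simp
  have hcard : (Fintype.piFinset fun i => if i ∈ J then {σ₀ i} else (Finset.univ : Finset Bool)).card
      = 2 ^ (n - J.card) := by
    rw [Fintype.card_piFinset]
    have : ∀ i, (if i ∈ J then {σ₀ i} else (Finset.univ : Finset Bool)).card =
        if i ∈ J then 1 else 2 := fun i => by split_ifs <;> simp
    simp_rw [this]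
    rw [Finset.prod_ite, Finset.prod_const_one, one_mul, Finset.prod_const]
    congr 1
    rw [Finset.filter_not, Finset.filter_mem_eq_inter, Finset.univ_inter, ← Finset.compl_eq_univ_sdiff,
      Finset.card_compl, Fintype.card_fin]
  have hJn : J.card ≤ n := by simpa using Finset.card_le_univ J
  calc S.card * 2 ^ k ≤ 2 ^ (n - J.card) * 2 ^ J.card := by
        refine Nat.mul_le_mul ((Finset.card_le_card hsub).trans hcard.le) ?_
        exact Nat.pow_le_pow_right (by norm_num) hk
    _ = 2 ^ n := by rw [← pow_add, Nat.sub_add_cancel hJn]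

/-- Swap the two entries of a pair of samples at the places where `σ` is true. -/
def swapAt (σ : Fin n → Bool) (z : Fin n → Ω × Ω) : Fin n → Ω × Ω :=
  fun i => if σ i then (z i).swap else z i

lemma swapAt_fst (σ : Fin n → Bool) (z : Fin n → Ω × Ω) (i : Fin n) :
    (swapAt σ z i).1 = if σ i then (z i).2 else (z i).1 := by
  unfold swapAt; split_ifs <;> rfl

lemma swapAt_snd (σ : Fin n → Bool) (z : Fin n → Ω × Ω) (i : Fin n) :
    (swapAt σ z i).2 = if !σ i then (z i).2 else (z i).1 := by
  unfold swapAt; cases σ i <;> rfl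

open Classical in
/-- Pairs of samples such that some member of `F` is missed by the first sample and hit
at least `k` times by the second one. -/
def badPairs (F : Set (Set Ω)) (n k : ℕ) : Set (Fin n → Ω × Ω) :=
  {z | ∃ B ∈ F, (∀ i, (z i).1 ∉ B) ∧ k ≤ (Finset.univ.filter fun i => (z i).2 ∈ B).card}

/-- At most `G` different traces are cut out by `F` from `2n` points. -/
def HasGrowthBound (F : Set (Set Ω)) (n G : ℕ) : Prop :=
  ∀ w : Fin n × Bool → Ω, ∃ 𝒯 : Finset (Finset (Fin n × Bool)), 𝒯.card ≤ G ∧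
    ∀ B ∈ F, ∃ T ∈ 𝒯, ∀ q, q ∈ T ↔ w q ∈ B

-- For fixed `z`, a set `B` matters only through its trace on the `2n` entries of `z`, so a union
-- bound over at most `G` traces reduces to `card_swaps_mul_le`.
open Classical in
lemma HasGrowthBound.card_swapAt_mem_mul_le {F : Set (Set Ω)} {G : ℕ} (hG : HasGrowthBound F n G)
    (z : Fin n → Ω × Ω) :
    (Finset.univ.filter fun σ : Fin n → Bool => swapAt σ z ∈ badPairs F n k).card * 2 ^ k
      ≤ G * 2 ^ n := by
  obtain ⟨𝒯, h𝒯, hF⟩ := hG fun q => if q.2 then (z q.1).2 else (z q.1).1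
  have hsub : (Finset.univ.filter fun σ : Fin n → Bool => swapAt σ z ∈ badPairs F n k) ⊆
      𝒯.biUnion fun T => Finset.univ.filter fun σ : Fin n → Bool =>
        (∀ i, (i, σ i) ∉ T) ∧ k ≤ (Finset.univ.filter fun i => (i, !σ i) ∈ T).card := by
    intro σ hσ
    obtain ⟨-, B, hB, h1, h2⟩ := Finset.mem_filter.1 hσ
    obtain ⟨T, hT, hTB⟩ := hF B hB
    refine Finset.mem_biUnion.2 ⟨T, hT, Finset.mem_filter.2 ⟨Finset.mem_univ _, fun i => ?_, ?_⟩⟩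
    · rw [hTB, ← swapAt_fst]; exact h1 i
    · simpa only [hTB, ← swapAt_snd] using h2
  calc _ ≤ (∑ T ∈ 𝒯, (Finset.univ.filter fun σ : Fin n → Bool => (∀ i, (i, σ i) ∉ T) ∧
          k ≤ (Finset.univ.filter fun i => (i, !σ i) ∈ T).card).card) * 2 ^ k :=
        Nat.mul_le_mul_right _ ((Finset.card_le_card hsub).trans Finset.card_biUnion_le)
    _ ≤ ∑ _T ∈ 𝒯, 2 ^ n := by
        rw [Finset.sum_mul]; exact Finset.sum_le_sum fun T _ => card_swaps_mul_le T
    _ ≤ G * 2 ^ n := by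
        rw [Finset.sum_const, smul_eq_mul]; exact Nat.mul_le_mul_right _ h𝒯

variable [MeasurableSpace Ω] {μ : Measure Ω} [IsProbabilityMeasure μ]

lemma measurableSet_badPairs {F : Set (Set Ω)} (hF : F.Countable)
    (hm : ∀ B ∈ F, MeasurableSet B) : MeasurableSet (badPairs F n k) := by
  classical
  have : badPairs F n k = ⋃ B ∈ F, ((⋂ i, {z | (z i).1 ∈ Bᶜ}) ∩
      {z | k ≤ ∑ i, if (z i).2 ∈ B then 1 else 0}) := by
    ext z
    simp only [badPairs, Finset.card_filter, Set.mem_iUnion, Set.mem_inter_iff, Set.mem_iInter,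
      exists_prop]
    rfl
  rw [this]
  refine MeasurableSet.biUnion hF fun B hB => MeasurableSet.inter ?_ ?_
  · exact MeasurableSet.iInter fun i => (hm B hB).compl.preimage (by fun_prop)
  · refine measurableSet_le measurable_const (Finset.measurable_sum _ fun i _ => ?_)
    exact Measurable.ite ((hm B hB).preimage (by fun_prop)) measurable_const measurable_const

lemma measurePreserving_swapAt (σ : Fin n → Bool) :
    MeasurePreserving (swapAt σ) (Measure.pi fun _ : Fin n => μ.prod μ)
      (Measure.pi fun _ : Fin n => μ.prod μ) := by
  have := measurePreserving_pi (fun _ : Fin n => μ.prod μ) (fun _ : Fin n => μ.prod μ)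
    (f := fun i p => if σ i then p.swap else p) fun i => by
      cases σ i
      · exact MeasurePreserving.id _
      · exact Measure.measurePreserving_swap
  exact this

/-- Symmetrization: bad pairs of samples are rare. -/
lemma HasGrowthBound.measure_badPairs_mul_le {F : Set (Set Ω)} {G : ℕ} (hG : HasGrowthBound F n G)
    (hF : F.Countable) (hm : ∀ B ∈ F, MeasurableSet B) :
    (Measure.pi fun _ : Fin n => μ.prod μ) (badPairs F n k) * 2 ^ k ≤ G := by
  classical
  set ν := Measure.pi fun _ : Fin n => μ.prod μ
  set E := badPairs F n k
  have hE : MeasurableSet E := measurableSet_badPairs hF hm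
  -- Each swap preserves `ν`, so averaging over all swaps turns the measure of `E` into a count for
  -- fixed `z`.
  have hsum : (2 : ℝ≥0∞) ^ n * ν E =
      ∫⁻ z, ((Finset.univ.filter fun σ : Fin n → Bool => swapAt σ z ∈ E).card : ℝ≥0∞) ∂ν := by
    have h1 : ∀ z, ((Finset.univ.filter fun σ : Fin n → Bool => swapAt σ z ∈ E).card : ℝ≥0∞) =
        ∑ σ : Fin n → Bool, (swapAt σ ⁻¹' E).indicator 1 z := fun z => by
      rw [Finset.card_filter]
      push_cast
      rfl
    simp_rw [h1]
    rw [lintegral_finsetSum _ fun σ _ =>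
      measurable_one.indicator ((measurePreserving_swapAt (μ := μ) σ).measurable hE)]
    have h2 : ∀ σ : Fin n → Bool, ∫⁻ z, (swapAt σ ⁻¹' E).indicator 1 z ∂ν = ν E := fun σ => by
      have hσ : MeasurePreserving (swapAt σ) ν ν := measurePreserving_swapAt σ
      rw [lintegral_indicator_one (hσ.measurable hE), hσ.measure_preimage hE.nullMeasurableSet]
    simp_rw [h2]
    simp
  have h2 : (2 : ℝ≥0∞) ^ n * (ν E * 2 ^ k) ≤ 2 ^ n * G := by
    rw [← mul_assoc, hsum, ← lintegral_mul_const' _ _ (by simp)]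
    calc _ ≤ ∫⁻ _z, (2 : ℝ≥0∞) ^ n * G ∂ν := by
          refine lintegral_mono fun z => ?_
          have : (Finset.univ.filter fun σ : Fin n → Bool => swapAt σ z ∈ E).card * 2 ^ k
              ≤ G * 2 ^ n := hG.card_swapAt_mem_mul_le z
          rw [mul_comm G] at this
          have h := (Nat.cast_le (α := ℝ≥0∞)).2 this
          push_cast at h
          exact h
      _ = _ := by simp
  exact (ENNReal.mul_le_mul_iff_right (by simp) (by simp)).1 h2

open Classical in
/-- Lower tail bound for the number of sample points in a set. -/
lemma measureReal_few_hits_le {B : Set Ω} (hB : MeasurableSet B) {p : ℝ} (hp : p ≤ μ.real B) :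
    (Measure.pi fun _ : Fin n => μ).real
      {Y | (Finset.univ.filter fun i => Y i ∈ B).card < k} ≤ 2 ^ k * (1 - p / 2) ^ n := by
  set ν := Measure.pi fun _ : Fin n => μ
  -- The product of the `f (Y i)` is `2^(-hits)`; its mean factorizes by independence, and Markov's
  -- inequality is applied to it.
  let f : Ω → ℝ := fun x => 1 - B.indicator (fun _ => 1 / 2) x
  have hfm : Measurable f := measurable_const.sub (measurable_const.indicator hB)
  have hf0 : ∀ x, 0 ≤ f x ∧ f x ≤ 1 := fun x => by
    simp only [f, Set.indicator_apply]; split_ifs <;> norm_num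
  have hint : ∫ x, f x ∂μ = 1 - μ.real B / 2 := by
    rw [integral_sub (integrable_const _) ((integrable_const _).indicator hB),
      integral_indicator_const _ hB]
    simp [div_eq_mul_inv]
  have hprod : ∀ Y : Fin n → Ω, ∏ i, f (Y i) =
      (1 / 2) ^ (Finset.univ.filter fun i => Y i ∈ B).card := fun Y => by
    have : ∀ i, f (Y i) = if Y i ∈ B then 1 / 2 else 1 := fun i => by
      simp only [f, Set.indicator_apply]; split_ifs <;> norm_num
    simp_rw [this, Finset.prod_ite]
    simp
  have hI : ∫ Y, ∏ i, f (Y i) ∂ν = (1 - μ.real B / 2) ^ n := by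
    rw [integral_fintype_prod_eq_pow, hint, Fintype.card_fin]
  have hint' : Integrable (fun Y : Fin n → Ω => ∏ i, f (Y i)) ν := by
    refine Integrable.of_bound (C := 1) ?_ (Filter.Eventually.of_forall fun Y => ?_)
    · exact (Finset.measurable_prod _ fun i _ =>
        hfm.comp (measurable_pi_apply i)).aestronglyMeasurable
    · rw [Real.norm_of_nonneg (Finset.prod_nonneg fun i _ => (hf0 _).1)]
      exact Finset.prod_le_one (fun i _ => (hf0 _).1) fun i _ => (hf0 _).2
  have hmarkov := mul_meas_ge_le_integral_of_nonneg
    (Filter.Eventually.of_forall fun Y => Finset.prod_nonneg fun i _ => (hf0 _).1) hint'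
    ((1 / 2) ^ k)
  have hle : (1 - μ.real B / 2) ^ n ≤ (1 - p / 2) ^ n := by
    have : μ.real B ≤ 1 := measureReal_le_one
    exact pow_le_pow_left₀ (by linarith) (by linarith) n
  have hsub : {Y : Fin n → Ω | (Finset.univ.filter fun i => Y i ∈ B).card < k} ⊆
      {Y | (1 / 2) ^ k ≤ ∏ i, f (Y i)} := fun Y hY => by
    rw [Set.mem_ofPred_eq, hprod]
    exact pow_le_pow_of_le_one (by norm_num) (by norm_num) (le_of_lt hY)
  have hmono : ν.real {Y | (Finset.univ.filter fun i => Y i ∈ B).card < k} ≤ _ :=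
    measureReal_mono hsub
  calc _ = 2 ^ k * ((1 / 2) ^ k * ν.real {Y | (Finset.univ.filter fun i => Y i ∈ B).card < k}) := by
        rw [← mul_assoc, ← mul_pow]; norm_num
    _ ≤ 2 ^ k * (1 - p / 2) ^ n := by
        gcongr
        refine le_trans ?_ ((hmarkov.trans hI.le).trans hle)
        gcongr

/-- The `ε`-net theorem: if `F` cuts out few traces, then some sample of size `n` hits every
member of `F` that is not too small. -/
theorem HasGrowthBound.exists_sample {F : Set (Set Ω)} {G : ℕ} (hG : HasGrowthBound F n G)
    (hF : F.Countable) (hm : ∀ B ∈ F, MeasurableSet B) {p : ℝ} (hp : ∀ B ∈ F, p ≤ μ.real B)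
    (hnum : (G : ℝ) / 2 ^ k + 2 ^ k * (1 - p / 2) ^ n < 1) :
    ∃ X : Fin n → Ω, ∀ B ∈ F, ∃ i, X i ∈ B := by
  classical
  by_contra! hbad
  have hE : MeasurableSet (badPairs F n k) := measurableSet_badPairs hF hm
  have hmp := (measurePreserving_arrowProdEquivProdArrow Ω Ω (Fin n) (fun _ => μ) (fun _ => μ)).symm
  -- Each first sample `X` misses some `B`, and an independent second sample hits this `B` at least
  -- `k` times except with probability `2^k (1 - p/2)^n`.
  have hlow : ENNReal.ofReal (1 - 2 ^ k * (1 - p / 2) ^ n) ≤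
      (Measure.pi fun _ : Fin n => μ.prod μ) (badPairs F n k) := by
    rw [← hmp.measure_preimage hE.nullMeasurableSet, Measure.prod_apply (hmp.measurable hE)]
    calc _ = ∫⁻ _X : Fin n → Ω, ENNReal.ofReal (1 - 2 ^ k * (1 - p / 2) ^ n)
          ∂(Measure.pi fun _ => μ) := by simp
      _ ≤ _ := by
        refine lintegral_mono fun X => ?_
        obtain ⟨B, hB, hX⟩ := hbad X
        have hcompl : MeasurableSet {Y : Fin n → Ω | (Finset.univ.filter fun i => Y i ∈ B).card < k} := by
          simp_rw [Finset.card_filter]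
          refine measurableSet_lt (Finset.measurable_sum _ fun i _ => ?_) measurable_const
          exact Measurable.ite ((hm B hB).preimage (by fun_prop)) measurable_const measurable_const
        have h1 := measureReal_few_hits_le (n := n) (k := k) (hm B hB) (hp B hB)
        have h2 := probReal_compl_eq_one_sub (μ := Measure.pi fun _ : Fin n => μ) hcompl
        refine (ENNReal.ofReal_le_ofReal (show _ ≤ (Measure.pi fun _ : Fin n => μ).real
          {Y : Fin n → Ω | (Finset.univ.filter fun i => Y i ∈ B).card < k}ᶜ by linarith)).trans ?_
        rw [ofReal_measureReal]
        refine measure_mono fun Y hY => ?_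
        exact ⟨B, hB, hX, not_lt.1 hY⟩
  have hup := hG.measure_badPairs_mul_le (μ := μ) (k := k) hF hm
  have h3 : ENNReal.ofReal ((1 - 2 ^ k * (1 - p / 2) ^ n) * 2 ^ k) ≤ ENNReal.ofReal G := by
    rw [ENNReal.ofReal_mul' (by positivity), ENNReal.ofReal_pow (by norm_num)]
    refine le_trans ?_ (hup.trans (by simp))
    simpa using mul_le_mul_left hlow (2 ^ k)
  rw [ENNReal.ofReal_le_ofReal_iff (Nat.cast_nonneg G), ← le_div_iff₀ (by positivity)] at h3
  linarith

end EpsilonNet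

/-! ### VC dimension of caps and growth of slices -/

section CapTraces

variable {d : ℕ} {ι : Type*} [Fintype ι] [DecidableEq ι]

open Classical in
/-- The subsets of a finite family of points that are cut out by caps. -/
noncomputable def capTraces (w : ι → Sph d) : Finset (Finset ι) :=
  Finset.univ.filter fun T => ∃ (x : Sph d) (t : ℝ), ∀ q, q ∈ T ↔ w q ∈ cap x t

/-- Among `d + 3` points of `ℝ^(d+1)` Radon's theorem finds two complementary parts with
intersecting convex hulls; no half-space, hence no cap, separates them. -/
lemma vcDim_capTraces_le (w : ι → Sph d) : (capTraces w).vcDim ≤ d + 2 := by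
  classical
  refine Finset.sup_le fun s hs => ?_
  rw [Finset.mem_shatterer] at hs
  by_contra! hcard
  have hdep : ¬ AffineIndependent ℝ fun i : s => (w i : EuclideanSpace ℝ (Fin (d + 1))) := by
    intro h
    have h1 := h.card_le_finrank_succ
    have h2 := Submodule.finrank_le (vectorSpan ℝ (Set.range fun i : s =>
      (w i : EuclideanSpace ℝ (Fin (d + 1)))))
    simp only [finrank_euclideanSpace, Fintype.card_fin, Fintype.card_coe] at h1 h2
    omega
  obtain ⟨I, v, hv1, hv2⟩ := Convex.radon_partition hdep
  obtain ⟨T, hT, hsT⟩ := hs (t := s.filter fun i => ∃ h : i ∈ s, (⟨i, h⟩ : s) ∈ I)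
    (Finset.filter_subset _ _)
  obtain ⟨-, x, t, hxt⟩ := Finset.mem_filter.1 hT
  have hmem : ∀ i : s, i ∈ I ↔ t < inner ℝ x.1 (w i).1 := fun i => by
    have h1 : (i : ι) ∈ s ∩ T ↔ (i : ι) ∈ s ∧ ∃ h : (i : ι) ∈ s, (⟨i, h⟩ : s) ∈ I := by
      rw [hsT]; exact Finset.mem_filter
    have h2 : (i : ι) ∈ T ↔ t < inner ℝ x.1 (w i).1 := hxt i
    rw [Finset.mem_inter, h2] at h1
    simpa using h1.symm
  have hlin : IsLinearMap ℝ fun y : EuclideanSpace ℝ (Fin (d + 1)) => (inner ℝ x.1 y : ℝ) :=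
    (innerSL ℝ x.1).toLinearMap.isLinear
  have h1 : t < inner ℝ x.1 v := convexHull_min (s := _) (t := {y | t < inner ℝ x.1 y})
    (by rintro _ ⟨i, hi, rfl⟩; exact (hmem i).1 hi) (convex_halfSpace_gt hlin t) hv1
  have h2 : inner ℝ x.1 v ≤ t := convexHull_min (s := _) (t := {y | inner ℝ x.1 y ≤ t})
    (by rintro _ ⟨i, hi, rfl⟩; exact not_lt.1 fun h => hi ((hmem i).2 h))
    (convex_halfSpace_le hlin t) hv2
  linarith

lemma card_capTraces_le (w : ι → Sph d) :
    (capTraces w).card ≤ ∑ k ∈ Finset.Iic (d + 2), (Fintype.card ι).choose k :=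
  (Finset.card_le_card_shatterer _).trans <| Finset.card_shatterer_le_sum_vcDim.trans <|
    Finset.sum_le_sum_of_subset (Finset.Iic_subset_Iic.2 (vcDim_capTraces_le w))

end CapTraces

/-- With `r = D / N ≤ 1`, multiplying by `r^D` bounds the sum by `(1 + r)^N ≤ e^D`. -/
lemma sum_choose_le {N D : ℕ} (hD : 1 ≤ D) (hDN : D ≤ N) :
    (∑ k ∈ Finset.Iic D, (N.choose k : ℝ)) ≤ (Real.exp 1 * N / D) ^ D := by
  have hD0 : (0 : ℝ) < D := by exact_mod_cast hD
  have hN0 : (0 : ℝ) < N := by exact_mod_cast hD.trans hDN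
  set r : ℝ := D / N with hr
  have hr0 : 0 < r := by positivity
  have hr1 : r ≤ 1 := (div_le_one hN0).2 (by exact_mod_cast hDN)
  have h1 : (∑ k ∈ Finset.Iic D, (N.choose k : ℝ)) * r ^ D ≤ Real.exp 1 ^ D := by
    calc (∑ k ∈ Finset.Iic D, (N.choose k : ℝ)) * r ^ D
        ≤ ∑ k ∈ Finset.Iic D, (N.choose k : ℝ) * r ^ k := by
          rw [Finset.sum_mul]
          refine Finset.sum_le_sum fun k hk => ?_
          exact mul_le_mul_of_nonneg_left
            (pow_le_pow_of_le_one hr0.le hr1 (Finset.mem_Iic.1 hk)) (Nat.cast_nonneg _)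
      _ ≤ ∑ k ∈ Finset.range (N + 1), (N.choose k : ℝ) * r ^ k := by
          refine Finset.sum_le_sum_of_subset_of_nonneg (fun k hk => ?_) fun k _ _ => by positivity
          rw [Finset.mem_range]
          have := Finset.mem_Iic.1 hk
          omega
      _ = (r + 1) ^ N := by
          rw [add_pow]
          refine Finset.sum_congr rfl fun k _ => ?_
          ring
      _ ≤ Real.exp r ^ N := pow_le_pow_left₀ (by positivity) (Real.add_one_le_exp r) N
      _ = Real.exp 1 ^ D := by
          rw [← Real.exp_nat_mul, ← Real.exp_nat_mul, hr]
          congr 1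
          field_simp
  have h2 : (Real.exp 1 * N / D) ^ D = Real.exp 1 ^ D / r ^ D := by
    rw [← div_pow, hr]
    congr 1
    field_simp
  rw [h2]
  exact (le_div_iff₀ (by positivity)).2 h1

lemma hasGrowthBound_of_subset_inter_caps {d n : ℕ} {F : Set (Set (Sph d))}
    (hF : ∀ B ∈ F, ∃ x y s t, B = cap x s ∩ cap y t) :
    HasGrowthBound F n ((∑ k ∈ Finset.Iic (d + 2), (2 * n).choose k) ^ 2) := by
  classical
  intro w
  have hc := card_capTraces_le w
  have hcard : Fintype.card (Fin n × Bool) = 2 * n := by simp [mul_comm]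
  rw [hcard] at hc
  refine ⟨Finset.image₂ (· ∩ ·) (capTraces w) (capTraces w), ?_, fun B hB => ?_⟩
  · refine (Finset.card_image₂_le _ _ _).trans ?_
    rw [sq]
    exact Nat.mul_le_mul hc hc
  · obtain ⟨x, y, s, t, rfl⟩ := hF B hB
    refine ⟨_, Finset.mem_image₂_of_mem
      (a := Finset.univ.filter fun q => w q ∈ cap x s)
      (b := Finset.univ.filter fun q => w q ∈ cap y t) ?_ ?_, fun q => ?_⟩
    · exact Finset.mem_filter.2 ⟨Finset.mem_univ _, x, s, by simp⟩
    · exact Finset.mem_filter.2 ⟨Finset.mem_univ _, y, t, by simp⟩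
    · simp

/-! ### Inner approximation by countably many slices -/

lemma cap_subset_cap {d : ℕ} (x : Sph d) {s t : ℝ} (h : s ≤ t) : cap x t ⊆ cap x s :=
  fun _ hz => h.trans_lt hz

lemma exists_cap_between {d : ℕ} {q : ℕ → Sph d} (hq : DenseRange q) (x : Sph d) (t : ℝ) {δ : ℝ}
    (hδ : 0 < δ) : ∃ (i : ℕ) (r : ℚ), cap x (t + δ) ⊆ cap (q i) r ∧ cap (q i) r ⊆ cap x t := by
  obtain ⟨i, hi⟩ := hq.exists_dist_lt x (half_pos hδ)
  obtain ⟨r, hr1, hr2⟩ := exists_rat_btwn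
    (show t + dist x (q i) < t + δ - dist x (q i) by linarith)
  have hdist : ∀ y : Sph d, |(inner ℝ x.1 y.1 : ℝ) - inner ℝ (q i).1 y.1| ≤ dist x (q i) := by
    intro y
    rw [← inner_sub_left]
    refine (abs_real_inner_le_norm _ _).trans ?_
    rw [show ‖y.1‖ = 1 by simp, mul_one, Subtype.dist_eq, dist_eq_norm]
  refine ⟨i, r, fun y hy => ?_, fun y hy => ?_⟩
  · have h1 : t + δ < inner ℝ x.1 y.1 := hy
    have := (abs_le.1 (hdist y)).2
    change (r : ℝ) < inner ℝ (q i).1 y.1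
    linarith
  · have h1 : (r : ℝ) < inner ℝ (q i).1 y.1 := hy
    have := (abs_le.1 (hdist y)).1
    change t < inner ℝ x.1 y.1
    linarith

/-- A slice is the increasing union of slices with slightly raised heights; by continuity from below
one of them still has measure above `c`, and a rational slice fits in between. -/
lemma exists_rational_slice_subset {d : ℕ} {q : ℕ → Sph d} (hq : DenseRange q) (x y : Sph d)
    (s t : ℝ) {c : ℝ≥0∞} (hc : c < unif d (cap x s ∩ cap y t)) :
    ∃ (i j : ℕ) (a b : ℚ), c < unif d (cap (q i) a ∩ cap (q j) b) ∧
      cap (q i) a ∩ cap (q j) b ⊆ cap x s ∩ cap y t := by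
  let U : ℕ → Set (Sph d) := fun m =>
    cap x (s + 1 / ((m : ℝ) + 1)) ∩ cap y (t + 1 / ((m : ℝ) + 1))
  have hanti : ∀ {m m' : ℕ}, m ≤ m' → 1 / ((m' : ℝ) + 1) ≤ 1 / ((m : ℝ) + 1) := fun h =>
    one_div_le_one_div_of_le (by positivity) (by simpa using h)
  have hU : Monotone U := fun m m' h => Set.inter_subset_inter
    (cap_subset_cap x (by linarith [hanti h])) (cap_subset_cap y (by linarith [hanti h]))
  have hUnion : cap x s ∩ cap y t = ⋃ m, U m := by
    apply Set.Subset.antisymm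
    · intro z hz
      have h1 : s < inner ℝ x.1 z.1 := hz.1
      have h2 : t < inner ℝ y.1 z.1 := hz.2
      obtain ⟨m, hm⟩ := exists_nat_one_div_lt (lt_min (sub_pos.2 h1) (sub_pos.2 h2))
      exact Set.mem_iUnion.2 ⟨m, lt_sub_iff_add_lt'.1 (hm.trans_le (min_le_left _ _)),
        lt_sub_iff_add_lt'.1 (hm.trans_le (min_le_right _ _))⟩
    · refine Set.iUnion_subset fun m => ?_
      have : 0 < 1 / ((m : ℝ) + 1) := by positivity
      exact Set.inter_subset_inter (cap_subset_cap x (by linarith)) (cap_subset_cap y (by linarith))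
  rw [hUnion, hU.measure_iUnion, lt_iSup_iff] at hc
  obtain ⟨m, hm⟩ := hc
  obtain ⟨i, a, h1, h2⟩ := exists_cap_between hq x s (δ := 1 / ((m : ℝ) + 1)) (by positivity)
  obtain ⟨j, b, h3, h4⟩ := exists_cap_between hq y t (δ := 1 / ((m : ℝ) + 1)) (by positivity)
  exact ⟨i, j, a, b, hm.trans_le (measure_mono (Set.inter_subset_inter h1 h3)),
    Set.inter_subset_inter h2 h4⟩

/-- If the numbers fit, then at most `n` points have dispersion at most `p`. -/
lemma exists_finset_disp_le {d n k : ℕ} {p : ℝ} (hn : 1 ≤ n)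
    (hnum : (((∑ k ∈ Finset.Iic (d + 2), (2 * n).choose k) ^ 2 : ℕ) : ℝ) / 2 ^ k
      + 2 ^ k * (1 - p / 2) ^ n < 1) :
    ∃ P : Finset (Sph d), 1 ≤ P.card ∧ P.card ≤ n ∧ disp P ≤ ENNReal.ofReal p := by
  classical
  have : Nonempty (Sph d) := (NormedSpace.sphere_nonempty.2 zero_le_one).to_subtype
  let q := TopologicalSpace.denseSeq (Sph d)
  have hq : DenseRange q := TopologicalSpace.denseRange_denseSeq _
  let f : (ℕ × ℕ) × (ℚ × ℚ) → Set (Sph d) := fun v => cap (q v.1.1) v.2.1 ∩ cap (q v.1.2) v.2.2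
  let F : Set (Set (Sph d)) := {B ∈ Set.range f | p ≤ (unif d).real B}
  have hgrowth : HasGrowthBound F n ((∑ k ∈ Finset.Iic (d + 2), (2 * n).choose k) ^ 2) :=
    hasGrowthBound_of_subset_inter_caps fun B hB => by
      obtain ⟨v, rfl⟩ := hB.1
      exact ⟨_, _, _, _, rfl⟩
  obtain ⟨X, hX⟩ := hgrowth.exists_sample (μ := unif d) (k := k) (p := p)
    ((Set.countable_range f).mono fun B hB => hB.1)
    (fun B hB => by
      obtain ⟨v, rfl⟩ := hB.1
      exact ((isOpen_cap _ _).inter (isOpen_cap _ _)).measurableSet)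
    (fun B hB => hB.2) hnum
  -- Sample points may coincide, so the cardinality is only at most `n`.
  refine ⟨Finset.univ.image X, ?_, Finset.card_image_le.trans (by simp), ?_⟩
  · exact Finset.card_pos.2 (Finset.Nonempty.image ⟨⟨0, hn⟩, Finset.mem_univ _⟩ X)
  · refine iSup₂_le fun B hB => ?_
    obtain ⟨⟨x, y, s, -, t, -, rfl⟩, hempty⟩ := hB
    by_contra! hlt
    obtain ⟨i, j, a, b, h1, h2⟩ := exists_rational_slice_subset hq x y t s hlt
    obtain ⟨l, hl⟩ := hX (f ((i, j), (a, b))) ⟨⟨_, rfl⟩, by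
      rw [measureReal_def, ← ENNReal.ofReal_le_iff_le_toReal (measure_ne_top _ _)]
      exact h1.le⟩
    have : X l ∈ ((Finset.univ.image X : Finset (Sph d)) : Set (Sph d)) ∩ (cap x t ∩ cap y s) :=
      ⟨by simp, h2 hl⟩
    rw [hempty] at this
    exact this

/-! ### Choice of the sample size -/

lemma seven_le_log {ε : ℝ} (hε : 0 < ε) (hε' : ε < 1 / (9 * Real.exp 1)) :
    7 ≤ Real.log (96 / ε) := by
  rw [Real.le_log_iff_exp_le (by positivity)]
  have he := Real.exp_one_lt_d9
  have he0 := Real.exp_pos 1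
  have h1 : 9 * Real.exp 1 < 1 / ε := by
    rw [lt_div_iff₀ (by positivity)] at hε'
    rw [lt_div_iff₀ hε]
    linarith
  have h2 : Real.exp 7 = Real.exp 1 ^ 6 * Real.exp 1 := by
    rw [← pow_succ, ← Real.exp_nat_mul]; norm_num
  have h3 : Real.exp 1 ^ 6 ≤ (2.72 : ℝ) ^ 6 := pow_le_pow_left₀ he0.le (by linarith) 6
  have h4 : Real.exp 1 ^ 6 * Real.exp 1 ≤ 864 * Real.exp 1 :=
    mul_le_mul_of_nonneg_right (h3.trans (by norm_num)) he0.le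
  have h5 : 96 / ε = 96 * (1 / ε) := by ring
  rw [h2, h5]
  linarith

/-- The growth bound for slices of `2n` points, with `n = ⌊96 (d / ε) log (96 / ε)⌋`. -/
lemma sum_choose_sq_le_exp {ε L : ℝ} {d n : ℕ} (hd : 1 ≤ d) (hL : 7 ≤ L)
    (hexp : Real.exp L = 96 / ε) (hn : (n : ℝ) ≤ 96 * (d / ε) * L) (hdn : 3 * d ≤ 2 * n) :
    (((∑ k ∈ Finset.Iic (d + 2), (2 * n).choose k) ^ 2 : ℕ) : ℝ) ≤ Real.exp (12 * d * L) := by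
  have hd0 : (0 : ℝ) < d := by exact_mod_cast hd
  -- The bound `d + 2 ≤ 3 * d` gives an exponent proportional to `d`.
  have h1 : ((∑ k ∈ Finset.Iic (d + 2), (2 * n).choose k : ℕ) : ℝ) ≤
      (Real.exp 1 * (2 * n : ℕ) / (3 * d : ℕ)) ^ (3 * d) := by
    refine le_trans ?_ (sum_choose_le (by omega) hdn)
    rw [← Nat.cast_sum]
    exact_mod_cast Finset.sum_le_sum_of_subset (Finset.Iic_subset_Iic.2 (by omega))
  have h2 : Real.exp 1 * (2 * n : ℕ) / (3 * d : ℕ) ≤ Real.exp (2 * L) := by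
    have he := Real.exp_one_lt_d9
    have hq := Real.quadratic_le_exp_of_nonneg (x := L) (by linarith)
    have h3 : (n : ℝ) ≤ d * (Real.exp L * L) := by
      rw [hexp]; refine hn.trans_eq ?_; ring
    have h4 : 2 * L ≤ Real.exp L := by nlinarith
    push_cast
    rw [div_le_iff₀ (by positivity)]
    calc Real.exp 1 * (2 * n) ≤ 3 * (2 * (d * (Real.exp L * L))) := by gcongr; linarith
      _ = Real.exp L * (2 * L) * (3 * d) := by ring
      _ ≤ Real.exp L * Real.exp L * (3 * d) := by gcongr
      _ = Real.exp (2 * L) * (3 * d) := by rw [← Real.exp_add, two_mul]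
  have h5 : ((∑ k ∈ Finset.Iic (d + 2), (2 * n).choose k : ℕ) : ℝ) ≤ Real.exp (6 * d * L) := by
    refine h1.trans ((pow_le_pow_left₀ (by positivity) h2 _).trans_eq ?_)
    rw [← Real.exp_nat_mul]
    congr 1
    push_cast
    ring
  push_cast at h5 ⊢
  refine (pow_le_pow_left₀ (by positivity) h5 2).trans_eq ?_
  rw [← Real.exp_nat_mul]
  congr 1
  push_cast
  ring

lemma sample_size_inequality {ε L : ℝ} {d n : ℕ} (hε : 0 < ε) (hε' : ε < 1 / 4) (hd : 1 ≤ d)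
    (hL : 7 ≤ L) (hexp : Real.exp L = 96 / ε) (hn : (n : ℝ) ≤ 96 * (d / ε) * L)
    (hn' : 96 * (d / ε) * L < n + 1) :
    (((∑ k ∈ Finset.Iic (d + 2), (2 * n).choose k) ^ 2 : ℕ) : ℝ) / 2 ^ ⌊ε * n / 5⌋₊
      + 2 ^ ⌊ε * n / 5⌋₊ * (1 - ε / 2 / 2) ^ n < 1 := by
  have hd1 : (1 : ℝ) ≤ d := by exact_mod_cast hd
  -- The factor `1 / 5` balances both terms: `k log 2` must exceed `12 d L`, the logarithm of the
  -- growth bound, yet stay below the decay exponent `ε n / 4`, each with a margin of `2`.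
  set k := ⌊ε * n / 5⌋₊ with hk
  have hdL : 7 ≤ d * L := by nlinarith
  have hεn : 95 * (d * L) ≤ ε * n := by
    have h1 : ε * (96 * (d / ε) * L) = 96 * (d * L) := by field_simp
    have h2 : ε * (96 * (d / ε) * L) ≤ ε * (n + 1) := by gcongr
    nlinarith
  have hdn : 3 * d ≤ 2 * n := by
    have h1 : (d : ℝ) * 7 ≤ d * L := by gcongr
    have h2 : ε * n ≤ 1 * n := by gcongr; linarith
    have : (3 * d : ℝ) ≤ 2 * n := by linarith
    exact_mod_cast this
  have hG := sum_choose_sq_le_exp hd hL hexp hn hdn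
  have hk1 : (k : ℝ) ≤ ε * n / 5 := Nat.floor_le (by positivity)
  have hk2 : ε * n / 5 < k + 1 := Nat.lt_floor_add_one _
  have h2k : (2 : ℝ) ^ k = Real.exp (k * Real.log 2) := by
    rw [Real.exp_nat_mul, Real.exp_log (by norm_num)]
  have hlo := Real.log_two_gt_d9
  have hhi := Real.log_two_lt_d9
  have h4 : Real.exp (-2) ≤ 1 / 4 := by
    have h1 : (2 : ℝ) ≤ Real.exp 1 := by have := Real.add_one_le_exp (1 : ℝ); linarith
    have h2 : (4 : ℝ) ≤ Real.exp 2 := by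
      rw [show (2 : ℝ) = 1 + 1 by norm_num, Real.exp_add]; nlinarith
    rw [Real.exp_neg, ← one_div]
    exact one_div_le_one_div_of_le (by norm_num) h2
  have hfirst : (((∑ k ∈ Finset.Iic (d + 2), (2 * n).choose k) ^ 2 : ℕ) : ℝ) / 2 ^ k ≤ 1 / 4 := by
    rw [h2k]
    refine le_trans ?_ h4
    rw [div_le_iff₀ (Real.exp_pos _), ← Real.exp_add]
    refine hG.trans (Real.exp_le_exp.2 ?_)
    have : (19 * (d * L) - 1) * 0.69 ≤ k * Real.log 2 := by
      gcongr
      · linarith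
      · linarith
    linarith
  have hsecond : 2 ^ k * (1 - ε / 2 / 2) ^ n ≤ 1 / 4 := by
    have h1 : (1 - ε / 2 / 2) ^ n ≤ Real.exp (-(ε * n / 4)) := by
      have h5 := Real.add_one_le_exp (-(ε / 4))
      refine (pow_le_pow_left₀ (by linarith) (show 1 - ε / 2 / 2 ≤ Real.exp (-(ε / 4)) by linarith)
        n).trans_eq ?_
      rw [← Real.exp_nat_mul]
      congr 1
      ring
    calc 2 ^ k * (1 - ε / 2 / 2) ^ n ≤ Real.exp (k * Real.log 2) * Real.exp (-(ε * n / 4)) := by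
          rw [h2k]; gcongr
      _ = Real.exp (k * Real.log 2 + -(ε * n / 4)) := by rw [Real.exp_add]
      _ ≤ Real.exp (-2) := by
          refine Real.exp_le_exp.2 ?_
          have : k * Real.log 2 ≤ ε * n / 5 * 0.7 := by gcongr; linarith
          linarith
      _ ≤ 1 / 4 := h4
  linarith

lemma exists_mem_admissible {ε : ℝ} (hε : 0 < ε) (hε' : ε < 1 / (9 * Real.exp 1)) {d : ℕ}
    (hd : 1 ≤ d) :
    ∃ m ∈ admissible ε d, (m : ℝ) ≤ 96 * ((d : ℝ) / ε) * Real.log (96 / ε) := by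
  have hL := seven_le_log hε hε'
  set L := Real.log (96 / ε) with hLdef
  have hexp : Real.exp L = 96 / ε := Real.exp_log (by positivity)
  have hε4 : ε < 1 / 4 := by
    refine hε'.trans (one_div_lt_one_div_of_lt (by norm_num) ?_)
    have := Real.add_one_le_exp (1 : ℝ)
    linarith
  have hd1 : (1 : ℝ) ≤ d := by exact_mod_cast hd
  have hA : 1 ≤ 96 * ((d : ℝ) / ε) * L := by
    have : 1 ≤ (d : ℝ) / ε := by rw [le_div_iff₀ hε]; linarith
    nlinarith
  set n := ⌊96 * ((d : ℝ) / ε) * L⌋₊ with hn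
  have hn1 : (n : ℝ) ≤ 96 * (d / ε) * L := Nat.floor_le (by linarith)
  have hn2 : 96 * (d / ε) * L < n + 1 := Nat.lt_floor_add_one _
  -- The level `ε / 2` makes the dispersion strictly smaller than `ε`.
  obtain ⟨P, hP1, hPn, hP⟩ := exists_finset_disp_le (d := d) (p := ε / 2)
    ((Nat.one_le_floor_iff _).2 hA) (sample_size_inequality hε hε4 hd hL hexp hn1 hn2)
  refine ⟨P.card, ⟨hP1, ?_⟩, le_trans (by exact_mod_cast hPn) hn1⟩
  calc minDisp P.card d ≤ disp P := iInf₂_le P (by simp)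
    _ ≤ ENNReal.ofReal (ε / 2) := hP
    _ < ENNReal.ofReal ε := (ENNReal.ofReal_lt_ofReal_iff hε).2 (by linarith)

/-! ### Final bounds and linear growth -/

lemma four_lt_one_div_two_mul {ε : ℝ} (hε : 0 < ε) (hε' : ε < 1 / (9 * Real.exp 1)) :
    4 < 1 / (2 * ε) := by
  have he := Real.add_one_le_exp (1 : ℝ)
  rw [lt_div_iff₀ (by positivity)] at hε' ⊢
  nlinarith

/-- The bounds on the inverse of the minimal spherical dispersion. -/
theorem invMinDisp_bounds {ε : ℝ} (hε : 0 < ε) (hε' : ε < 1 / (9 * Real.exp 1)) {d : ℕ}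
    (hd : 1 ≤ d) :
    IsLeast (admissible ε d) (invMinDisp ε d) ∧
      max (1 / ε + (d : ℝ) - 2) (1 / (2 * ε) + 2 * (d : ℝ) - 2) ≤ (invMinDisp ε d : ℝ) ∧
      (invMinDisp ε d : ℝ) ≤ 96 * ((d : ℝ) / ε) * Real.log (96 / ε) := by
  obtain ⟨m, hm, hmle⟩ := exists_mem_admissible hε hε' hd
  have hmem : invMinDisp ε d ∈ admissible ε d := Nat.sInf_mem ⟨m, hm⟩
  have hle : ∀ j ∈ admissible ε d, invMinDisp ε d ≤ j := fun j hj => Nat.sInf_le hj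
  have h4 := four_lt_one_div_two_mul hε hε'
  have h2 : 1 / ε = 2 * (1 / (2 * ε)) := by field_simp
  have hε4 : ε < 1 / 4 := by
    rw [lt_div_iff₀ (by positivity)] at h4
    linarith
  obtain ⟨hl1, hl2⟩ := lower_bounds_of_mem_admissible hε hε4 hd hmem
  -- Since `1 / (2ε) > 4`, the bound `1 / ε + 2d - 4` is stronger than `1 / (2ε) + 2d - 2`.
  refine ⟨⟨hmem, hle⟩, max_le hl1 (by linarith), ?_⟩
  exact le_trans (by exact_mod_cast hle m hm) hmle

end SphericalDispersion

theorem mainTheorem5 :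
    (∀ ε : ℝ, 0 < ε → ε < 1 / (9 * Real.exp 1) → ∀ d : ℕ, 1 ≤ d →
      IsLeast (SphericalDispersion.admissible ε d) (SphericalDispersion.invMinDisp ε d) ∧
      max (1 / ε + (d : ℝ) - 2) (1 / (2 * ε) + 2 * (d : ℝ) - 2)
        ≤ (SphericalDispersion.invMinDisp ε d : ℝ) ∧
      (SphericalDispersion.invMinDisp ε d : ℝ) ≤ 96 * ((d : ℝ) / ε) * Real.log (96 / ε)) ∧
    (∀ ε : ℝ, 0 < ε → ε < 1 / (9 * Real.exp 1) →
      ∃ c C : ℝ, 0 < c ∧ 0 < C ∧ ∀ d : ℕ, 1 ≤ d →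
        c * (d : ℝ) ≤ (SphericalDispersion.invMinDisp ε d : ℝ) ∧
        (SphericalDispersion.invMinDisp ε d : ℝ) ≤ C * (d : ℝ)) ∧
    (∀ d : ℕ, 1 ≤ d →
      ∃ c C : ℝ, 0 < c ∧ 0 < C ∧ ∀ ε : ℝ, 0 < ε → ε < 1 / (9 * Real.exp 1) →
        c * (1 / ε) ≤ (SphericalDispersion.invMinDisp ε d : ℝ) ∧
        (SphericalDispersion.invMinDisp ε d : ℝ) ≤ C * ((1 / ε) * Real.log (1 / ε))) := by
  refine ⟨fun ε hε hε' d hd => SphericalDispersion.invMinDisp_bounds hε hε' hd,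
    fun ε hε hε' => ?_, fun d hd => ?_⟩
  · have hL := SphericalDispersion.seven_le_log hε hε'
    refine ⟨1, 96 / ε * Real.log (96 / ε), one_pos, by positivity, fun d hd => ?_⟩
    obtain ⟨-, hlow, hup⟩ := SphericalDispersion.invMinDisp_bounds hε hε' hd
    have h1 := (le_max_right _ _).trans hlow
    have h4 := SphericalDispersion.four_lt_one_div_two_mul hε hε'
    have hd0 : (0 : ℝ) ≤ d := Nat.cast_nonneg d
    exact ⟨by linarith, hup.trans_eq (by ring)⟩
  · have hd1 : (1 : ℝ) ≤ d := by exact_mod_cast hd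
    -- `576 = 96 * 6`, where `6` comes from `96 ≤ 3^5 ≤ (1/ε)^5`.
    refine ⟨1 / 2, 576 * d, by norm_num, by positivity, fun ε hε hε' => ?_⟩
    obtain ⟨-, hlow, hup⟩ := SphericalDispersion.invMinDisp_bounds hε hε' hd
    have h1 := (le_max_left _ _).trans hlow
    have h4 := SphericalDispersion.four_lt_one_div_two_mul hε hε'
    have h2 : 1 / ε = 2 * (1 / (2 * ε)) := by field_simp
    refine ⟨by linarith, hup.trans ?_⟩
    have hlog : Real.log (96 / ε) ≤ 6 * Real.log (1 / ε) := by
      have h3 : (96 : ℝ) ≤ (1 / ε) ^ 5 := by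
        have : (3 : ℝ) ^ 5 ≤ (1 / ε) ^ 5 := pow_le_pow_left₀ (by norm_num) (by linarith) 5
        exact le_trans (by norm_num) this
      calc Real.log (96 / ε) ≤ Real.log ((1 / ε) ^ 6) := by
            refine Real.log_le_log (by positivity) ?_
            calc 96 / ε = 96 * (1 / ε) := by ring
              _ ≤ (1 / ε) ^ 5 * (1 / ε) := by gcongr
              _ = (1 / ε) ^ 6 := by ring
        _ = 6 * Real.log (1 / ε) := by rw [Real.log_pow]; norm_num
    calc 96 * ((d : ℝ) / ε) * Real.log (96 / ε)
        ≤ 96 * ((d : ℝ) / ε) * (6 * Real.log (1 / ε)) := by gcongr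
      _ = 576 * d * (1 / ε * Real.log (1 / ε)) := by ring
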